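/- Let $\Phi:\mathbb R\to\mathbb R$ be differentiable with $\Phi$ and $\Phi'$ bounded, let $n_0\ge 1$, and fix inputs $x,x'\in\mathbb R^{n_0}$ and a real exponent $p>0$. For a width $n_1\ge 1$ and parameters $\theta=(\theta^{(0)},\theta^{(1)})\in\mathbb R^{n_0\times n_1}\times\mathbb R^{n_1}$ put $$h_v(x;\theta)=\frac1{\sqrt{n_0}}\sum_{u=1}^{n_0}x_u\theta^{(0)}_{uv},\qquad f(x;\theta)=\frac1{\sqrt{n_1}}\sum_{v=1}^{n_1}\Phi\big(h_v(x;\theta)\big)\,\theta^{(1)}_v ,$$ and define the empirical neural tangent kernels of the network and of the hidden layer by $$k(x,x';\theta)=\big\langle\nabla_\theta f(x;\theta),\nabla_\theta f(x';\theta)\big\rangle,\qquad \tilde k_{uv}(x,x';\theta)=\big\langle\nabla_{\theta^{(0)}}h_u(x;\theta),\nabla_{\theta^{(0)}}h_v(x';\theta)\big\rangle\quad(1\le u,v\le n_1).$$ Let $\tilde{\mathcal K}(x,x')=\frac1{n_0}x^\top x'$, let $\mathcal T(x,x')=\begin{pmatrix}\tilde{\mathcal K}(x,x)&\tilde{\mathcal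 K}(x,x')\\ \tilde{\mathcal K}(x',x)&\tilde{\mathcal K}(x',x')\end{pmatrix}$, and for $(u,v)\sim\mathcal N(0,\mathcal T(x,x'))$ let $$\mathcal K(x,x')=\mathbb E[\Phi(u)\Phi(v)],\qquad k_\infty(x,x')=\mathcal K(x,x')+\tilde{\mathcal K}(x,x')\,\mathbb E[\Phi'(u)\Phi'(v)].$$ Then there is a constant $C>0$ (which may depend on $\Phi,n_0,x,x',p$ but not on $n_1$) such that for every width $n_1\ge1$, if the entries of $\theta^{(0)}$ and $\theta^{(1)}$ are independent standard Gaussian random variables, the following hold. 1. For every $i\in\{1,\dots,n_1\}$ (in particular for $i=1$), $\tilde k_{ii}(x,x';\cdot)$ is identically equal to $\tilde{\mathcal K}(x,x')$; in particular $\mathbb E\big[|\tilde k_{ii}(x,x';\theta)-\tilde{\mathcal K}(x,x')|^p\big]=0$. 2. $|k(x,x';\theta)-k_\infty(x,x')|^p$ is integrable and $$\mathbb E\big[|k(x,x';\theta)-k_\infty(x,x')|^p\big]\le\frac{C}{n_1^{p/2}} .$$ -/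

import Mathlib

open MeasureTheory ProbabilityTheory
open scoped RealInnerProductSpace

noncomputable section

namespace ShallowNN

/-- Indices of the parameters of a network with input dimension `n₀` and width `n₁`: `inl (u, v)` is
the entry `(u, v)` of the inner weights, `inr v` is the `v`-th outer weight. -/
abbrev ParamIdx (n₀ n₁ : ℕ) : Type := (Fin n₀ × Fin n₁) ⊕ Fin n₁

/-- The parameter space `ℝ^N`, `N = n₀ n₁ + n₁`, with its Euclidean structure. -/
abbrev Param (n₀ n₁ : ℕ) : Type := EuclideanSpace ℝ (ParamIdx n₀ n₁)

/-- The space of inner weights `ℝ^{n₀ × n₁}`, with its Euclidean (Frobenius) structure. -/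
abbrev InnerParam (n₀ n₁ : ℕ) : Type := EuclideanSpace ℝ (Fin n₀ × Fin n₁)

variable {n₀ n₁ : ℕ}

/-- The inner weights `θ⁽⁰⁾` of a parameter `θ`. -/
def innerWeights (θ : Param n₀ n₁) : InnerParam n₀ n₁ :=
  WithLp.toLp 2 fun q => θ (Sum.inl q)

/-- The preactivation of the `v`-th hidden neuron, as a function of the inner weights. -/
def preactivation (x : EuclideanSpace ℝ (Fin n₀)) (v : Fin n₁) (W : InnerParam n₀ n₁) : ℝ :=
  1 / √(n₀ : ℝ) * ∑ u, x u * W (u, v)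

/-- The output `f(x; θ)` of the network. -/
def network (Φ : ℝ → ℝ) (x : EuclideanSpace ℝ (Fin n₀)) (θ : Param n₀ n₁) : ℝ :=
  1 / √(n₁ : ℝ) * ∑ v, Φ (preactivation x v (innerWeights θ)) * θ (Sum.inr v)

/-- The empirical neural tangent kernel `k(x, x'; θ)`. -/
def empiricalNTK (Φ : ℝ → ℝ) (x x' : EuclideanSpace ℝ (Fin n₀)) (θ : Param n₀ n₁) : ℝ :=
  ⟪gradient (network Φ x) θ, gradient (network Φ x') θ⟫

/-- The empirical kernel at the hidden layer, an `n₁ × n₁` matrix. -/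
def hiddenNTK (x x' : EuclideanSpace ℝ (Fin n₀)) (θ : Param n₀ n₁) :
    Matrix (Fin n₁) (Fin n₁) ℝ :=
  Matrix.of fun u v =>
    ⟪gradient (preactivation x u) (innerWeights θ),
      gradient (preactivation x' v) (innerWeights θ)⟫

/-- The covariance `x ⬝ x' / n₀` of the preactivations. -/
def Ktilde (x x' : EuclideanSpace ℝ (Fin n₀)) : ℝ := 1 / (n₀ : ℝ) * ⟪x, x'⟫

/-- The `2 × 2` covariance matrix of the preactivations at the pair `(x, x')`. -/
def covMatrix (x x' : EuclideanSpace ℝ (Fin n₀)) : Matrix (Fin 2) (Fin 2) ℝ :=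
  !![Ktilde x x, Ktilde x x'; Ktilde x' x, Ktilde x' x']

/-- `covMatrix x x'` is a genuine covariance matrix. -/
lemma covMatrix_posSemidef (x x' : EuclideanSpace ℝ (Fin n₀)) :
    (covMatrix x x').PosSemidef := by
  have h : covMatrix x x' = (1 / (n₀ : ℝ)) • Matrix.gram ℝ ![x, x'] := by
    ext i j
    fin_cases i <;> fin_cases j <;> simp [covMatrix, Ktilde, Matrix.gram]
  rw [h]
  exact (Matrix.posSemidef_gram ℝ ![x, x']).smul (by positivity)

/-- `E[g(u) g(v)]` for `(u, v)` centered Gaussian with covariance `covMatrix x x'`. -/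
def gaussianKernel (g : ℝ → ℝ) (x x' : EuclideanSpace ℝ (Fin n₀)) : ℝ :=
  ∫ z, g (z 0) * g (z 1) ∂(multivariateGaussian 0 (covMatrix x x'))

/-- The limiting kernel `k_∞(x, x')`. -/
def limitNTK (Φ : ℝ → ℝ) (x x' : EuclideanSpace ℝ (Fin n₀)) : ℝ :=
  gaussianKernel Φ x x' + Ktilde x x' * gaussianKernel (deriv Φ) x x'

/-- Gaussian initialization: the coordinates of the random parameter `θ` are independent standard
Gaussian random variables. -/
structure IsGaussianInit {Ω : Type*} [MeasurableSpace Ω] (P : Measure Ω)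
    (θ : Ω → Param n₀ n₁) : Prop where
  indep : iIndepFun (fun (i : ParamIdx n₀ n₁) ω => θ ω i) P
  law : ∀ i : ParamIdx n₀ n₁, HasLaw (fun ω => θ ω i) (gaussianReal 0 1) P

end ShallowNN

end

/-! Preactivations are linear in the inner weights, so their gradients are constant and the claim on
the hidden layer is a computation. The empirical kernel is an average over neurons of terms `Φ a * Φ
b + K * (Φ' a * Φ' b * t ^ 2)` (`empiricalNTK_eq_sum`). These are independent with mean `limitNTK`:
`(a, b)` is Gaussian with covariance `covMatrix`, and `t` is independent of it with second moment 1.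
As `Φ` and `Φ'` are bounded, each term is at most a constant plus a multiple of `t ^ 2`, hence has
an exponential moment uniform in the width (`exists_integral_exp_centeredNeuronKernel_le`). The sum
of the centered terms divided by `√n₁` then has bounded moments of every order `p > 0`
(`exists_integral_rpow_abs_normalized_sum_le`), and a further factor `1 / √n₁` gives the rate. -/

namespace ShallowNN

/-! ### Gradients, and the empirical kernel as an average over neurons -/

/-- The gradient of the `v`-th preactivation with respect to the inner weights. -/
noncomputable def preactivationGrad {n₀ n₁ : ℕ} (x : EuclideanSpace ℝ (Fin n₀)) (v : Fin n₁) :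
    InnerParam n₀ n₁ :=
  WithLp.toLp 2 fun q => if q.2 = v then x q.1 / √(n₀ : ℝ) else 0

lemma preactivation_eq_inner {n₀ n₁ : ℕ} (x : EuclideanSpace ℝ (Fin n₀)) (v : Fin n₁)
    (W : InnerParam n₀ n₁) : preactivation x v W = ⟪preactivationGrad x v, W⟫ := by
  simp only [preactivation, preactivationGrad, PiLp.inner_apply, Fintype.sum_prod_type,
    Finset.mul_sum]
  refine Finset.sum_congr rfl fun u _ => ?_
  rw [Finset.sum_eq_single v]
  · simp only [if_true, RCLike.inner_apply, conj_trivial]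
    ring
  · intro w _ hw
    simp [hw]
  · simp

lemma hasFDerivAt_preactivation {n₀ n₁ : ℕ} (x : EuclideanSpace ℝ (Fin n₀)) (v : Fin n₁)
    (W : InnerParam n₀ n₁) :
    HasFDerivAt (preactivation x v) (innerSL ℝ (preactivationGrad x v)) W := by
  have h : preactivation x v = innerSL ℝ (preactivationGrad x v) :=
    funext fun W => preactivation_eq_inner x v W
  rw [h]
  exact (innerSL ℝ (preactivationGrad x v)).hasFDerivAt

lemma gradient_preactivation {n₀ n₁ : ℕ} (x : EuclideanSpace ℝ (Fin n₀)) (v : Fin n₁)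
    (W : InnerParam n₀ n₁) : gradient (preactivation x v) W = preactivationGrad x v :=
  HasGradientAt.gradient (hasFDerivAt_preactivation x v W)

lemma one_div_sqrt_mul_self (n : ℕ) : 1 / √(n : ℝ) * (1 / √(n : ℝ)) = 1 / (n : ℝ) := by
  rw [div_mul_div_comm, one_mul, Real.mul_self_sqrt (Nat.cast_nonneg _)]

lemma hiddenNTK_self {n₀ n₁ : ℕ} (x x' : EuclideanSpace ℝ (Fin n₀))
    (θ : Param n₀ n₁) (v : Fin n₁) : hiddenNTK x x' θ v v = Ktilde x x' := by
  -- The inner product of the two gradients is read back as a preactivation evaluated at a gradient,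
  -- so only column `v` remains.
  rw [hiddenNTK, Matrix.of_apply, gradient_preactivation, gradient_preactivation,
    ← preactivation_eq_inner]
  simp only [preactivation, preactivationGrad, if_true, Ktilde, PiLp.inner_apply, Finset.mul_sum,
    RCLike.inner_apply, conj_trivial]
  refine Finset.sum_congr rfl fun u _ => ?_
  rw [← one_div_sqrt_mul_self n₀]
  ring

/-- The inner weights as a continuous linear function of the parameter. -/
noncomputable def innerWeightsL (n₀ n₁ : ℕ) : Param n₀ n₁ →L[ℝ] InnerParam n₀ n₁ :=
  (EuclideanSpace.equiv (Fin n₀ × Fin n₁) ℝ).symm.toContinuousLinearMap ∘L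
    ContinuousLinearMap.pi fun q => EuclideanSpace.proj (Sum.inl q)

/-- The gradient of the network output. -/
noncomputable def networkGrad {n₀ n₁ : ℕ} (Φ : ℝ → ℝ) (x : EuclideanSpace ℝ (Fin n₀))
    (θ : Param n₀ n₁) : Param n₀ n₁ :=
  WithLp.toLp 2 <| Sum.elim
    (fun q => 1 / √(n₁ : ℝ) * (θ (Sum.inr q.2) * deriv Φ (preactivation x q.2 (innerWeights θ)) *
      (x q.1 / √(n₀ : ℝ))))
    (fun v => 1 / √(n₁ : ℝ) * Φ (preactivation x v (innerWeights θ)))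

lemma gradient_network {n₀ n₁ : ℕ} {Φ : ℝ → ℝ} (hΦ : Differentiable ℝ Φ)
    (x : EuclideanSpace ℝ (Fin n₀)) (θ : Param n₀ n₁) :
    gradient (network Φ x) θ = networkGrad Φ x θ := by
  refine HasGradientAt.gradient ?_
  rw [hasGradientAt_iff_hasFDerivAt]
  have hpre (v : Fin n₁) : HasFDerivAt (fun θ : Param n₀ n₁ => preactivation x v (innerWeights θ))
      (innerSL ℝ (preactivationGrad x v) ∘L innerWeightsL n₀ n₁) θ :=
    HasFDerivAt.comp θ (hasFDerivAt_preactivation x v (innerWeights θ))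
      (innerWeightsL n₀ n₁).hasFDerivAt
  have hout (v : Fin n₁) : HasFDerivAt (fun θ : Param n₀ n₁ => θ (Sum.inr v))
      (EuclideanSpace.proj (Sum.inr v) : Param n₀ n₁ →L[ℝ] ℝ) θ :=
    (EuclideanSpace.proj (Sum.inr v) : Param n₀ n₁ →L[ℝ] ℝ).hasFDerivAt
  have key := (HasFDerivAt.fun_sum (u := Finset.univ) fun v _ =>
    ((hΦ _).hasDerivAt.comp_hasFDerivAt θ (hpre v)).mul (hout v)).const_mul (1 / √(n₁ : ℝ))
  refine key.congr_fderiv ?_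
  ext y
  have hinner (v : Fin n₁) : innerSL ℝ (preactivationGrad x v) (innerWeightsL n₀ n₁ y) =
      1 / √(n₀ : ℝ) * ∑ u, x u * y (Sum.inl (u, v)) :=
    (preactivation_eq_inner x v (innerWeights y)).symm
  simp only [smul_apply, sum_apply,
    add_apply, ContinuousLinearMap.comp_apply, hinner,
    InnerProductSpace.toDual_apply_apply, PiLp.inner_apply, networkGrad, Fintype.sum_sum_type,
    Fintype.sum_prod_type, Sum.elim_inl, Sum.elim_inr, PiLp.proj_apply, smul_eq_mul,
    Finset.sum_add_distrib, Finset.mul_sum, mul_add, RCLike.inner_apply, conj_trivial]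
  rw [add_comm, Finset.sum_comm]
  congr 1
  · refine Finset.sum_congr rfl fun u _ => Finset.sum_congr rfl fun v _ => ?_
    ring
  · refine Finset.sum_congr rfl fun v _ => ?_
    simp only [Function.comp_apply]
    ring

/-- The contribution of a neuron to the empirical kernel, as a function of its preactivations
`a`, `b` at the two inputs and its outer weight `t`. -/
noncomputable def neuronKernel (Φ : ℝ → ℝ) (K a b t : ℝ) : ℝ :=
  Φ a * Φ b + K * (deriv Φ a * deriv Φ b * t ^ 2)

/-- Outer weights contribute the `Φ a * Φ b` terms; for inner weights the sum over inputs factors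
out as `Ktilde`. -/
lemma empiricalNTK_eq_sum {n₀ n₁ : ℕ} {Φ : ℝ → ℝ} (hΦ : Differentiable ℝ Φ)
    (x x' : EuclideanSpace ℝ (Fin n₀)) (θ : Param n₀ n₁) :
    empiricalNTK Φ x x' θ = 1 / (n₁ : ℝ) * ∑ v, neuronKernel Φ (Ktilde x x')
      (preactivation x v (innerWeights θ)) (preactivation x' v (innerWeights θ))
      (θ (Sum.inr v)) := by
  rw [empiricalNTK, gradient_network hΦ, gradient_network hΦ]
  simp only [networkGrad, neuronKernel, Ktilde, PiLp.inner_apply, Fintype.sum_sum_type,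
    Fintype.sum_prod_type, Sum.elim_inl, Sum.elim_inr, RCLike.inner_apply, conj_trivial,
    Finset.mul_sum, Finset.sum_mul, mul_add, Finset.sum_add_distrib]
  rw [add_comm, Finset.sum_comm]
  congr 1
  · refine Finset.sum_congr rfl fun v _ => ?_
    rw [← one_div_sqrt_mul_self n₁]
    ring
  · refine Finset.sum_congr rfl fun v _ => Finset.sum_congr rfl fun u _ => ?_
    rw [← one_div_sqrt_mul_self n₁, ← one_div_sqrt_mul_self n₀]
    ring

end ShallowNN

/-! ### Moments of normalized sums of independent variables -/

lemma exp_le_one_add_self_add_sq_mul_exp_abs (z : ℝ) :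
    Real.exp z ≤ 1 + z + z ^ 2 * Real.exp |z| := by
  have h := Complex.norm_exp_sub_sum_le_norm_mul_exp (z : ℂ) 2
  simp only [Finset.sum_range_succ, Finset.sum_range_zero, zero_add, pow_zero, Nat.factorial_zero,
    Nat.cast_one, div_one, pow_one, Nat.factorial_one, Complex.norm_real, Real.norm_eq_abs,
    sq_abs] at h
  have h' : Complex.exp z - (1 + z) = ((Real.exp z - (1 + z) : ℝ) : ℂ) := by push_cast; rfl
  rw [h', Complex.norm_real, Real.norm_eq_abs] at h
  linarith [(abs_le.1 h).2]

/-- The linear term is kept because it vanishes for centered variables. Half of the rate `s` absorbs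
`y ^ 2`, the other half absorbs `exp |τ * y|`; the 8 comes from `u ^ 2 / 2 ≤ exp u` at `u = s / 2 *
|y|`. -/
lemma exp_mul_le_one_add_mul_add_sq_mul_exp {s τ y : ℝ} (hs : 0 < s) (hτ : |τ| ≤ s / 2) :
    Real.exp (τ * y) ≤ 1 + τ * y + τ ^ 2 * (8 / s ^ 2 * Real.exp (s * |y|)) := by
  have h1 := exp_le_one_add_self_add_sq_mul_exp_abs (τ * y)
  have h2 : Real.exp |τ * y| ≤ Real.exp (s / 2 * |y|) := by
    rw [abs_mul]
    gcongr
  have h3 : y ^ 2 ≤ 8 / s ^ 2 * Real.exp (s / 2 * |y|) := by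
    have := Real.quadratic_le_exp_of_nonneg (x := s / 2 * |y|) (by positivity)
    have h4 : (s / 2 * |y|) ^ 2 / 2 ≤ Real.exp (s / 2 * |y|) := by
      nlinarith [show 0 ≤ s / 2 * |y| by positivity]
    rw [mul_pow, sq_abs] at h4
    rw [div_mul_eq_mul_div, le_div_iff₀ (by positivity)]
    nlinarith
  have h5 : Real.exp (s * |y|) = Real.exp (s / 2 * |y|) * Real.exp (s / 2 * |y|) := by
    rw [← Real.exp_add]
    ring_nf
  have h6 : (τ * y) ^ 2 * Real.exp |τ * y| ≤ τ ^ 2 * (8 / s ^ 2 * Real.exp (s * |y|)) := by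
    rw [mul_pow, mul_assoc, h5, ← mul_assoc (8 / s ^ 2)]
    gcongr
  linarith

lemma integrable_of_integrable_exp_mul_abs {Ω : Type*} [MeasurableSpace Ω] {P : Measure Ω}
    {Y : Ω → ℝ} {s : ℝ} (hs : 0 < s) (hY : AEMeasurable Y P)
    (hint : Integrable (fun ω => Real.exp (s * |Y ω|)) P) : Integrable Y P := by
  refine (hint.const_mul s⁻¹).mono' hY.aestronglyMeasurable (ae_of_all _ fun ω => ?_)
  rw [Real.norm_eq_abs, inv_mul_eq_div, le_div_iff₀ hs, mul_comm]
  linarith [Real.add_one_le_exp (s * |Y ω|)]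

lemma integrable_exp_mul_of_integrable_exp_mul_abs {Ω : Type*} [MeasurableSpace Ω]
    {P : Measure Ω} {Y : Ω → ℝ} {s τ : ℝ} (hτ : |τ| ≤ s) (hY : AEMeasurable Y P)
    (hint : Integrable (fun ω => Real.exp (s * |Y ω|)) P) :
    Integrable (fun ω => Real.exp (τ * Y ω)) P := by
  refine hint.mono' (by fun_prop) (ae_of_all _ fun ω => ?_)
  rw [Real.norm_eq_abs, Real.abs_exp]
  refine Real.exp_le_exp.2 ((le_abs_self _).trans ?_)
  rw [abs_mul]
  gcongr

/-- A centered random variable with an exponential moment is sub-Gaussian near the origin. -/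
lemma mgf_le_exp_sq_of_integral_eq_zero {Ω : Type*} [MeasurableSpace Ω] {P : Measure Ω}
    [IsProbabilityMeasure P] {Y : Ω → ℝ} {s τ M : ℝ} (hs : 0 < s) (hτ : |τ| ≤ s / 2)
    (hY : AEMeasurable Y P) (hint : Integrable (fun ω => Real.exp (s * |Y ω|)) P)
    (hM : ∫ ω, Real.exp (s * |Y ω|) ∂P ≤ M) (h0 : ∫ ω, Y ω ∂P = 0) :
    mgf Y P τ ≤ Real.exp (τ ^ 2 * (8 / s ^ 2 * M)) := by
  have hYi := integrable_of_integrable_exp_mul_abs hs hY hint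
  calc mgf Y P τ
      ≤ ∫ ω, (1 + τ * Y ω + τ ^ 2 * (8 / s ^ 2 * Real.exp (s * |Y ω|))) ∂P := by
        refine integral_mono (integrable_exp_mul_of_integrable_exp_mul_abs (by linarith) hY hint)
          (((integrable_const _).add (hYi.const_mul _)).add ((hint.const_mul _).const_mul _))
          fun ω => exp_mul_le_one_add_mul_add_sq_mul_exp hs hτ
    _ = 1 + τ ^ 2 * (8 / s ^ 2 * ∫ ω, Real.exp (s * |Y ω|) ∂P) := by
        have h1 : Integrable (fun ω => 1 + τ * Y ω) P :=
          (integrable_const _).add (hYi.const_mul _)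
        rw [integral_add h1 ((hint.const_mul _).const_mul _),
          integral_add (integrable_const _) (hYi.const_mul _)]
        simp [integral_const_mul, h0]
    _ ≤ 1 + τ ^ 2 * (8 / s ^ 2 * M) := by gcongr
    _ ≤ _ := by linarith [Real.add_one_le_exp (τ ^ 2 * (8 / s ^ 2 * M))]

/-- Moment bound, uniform in the number of summands, for normalized sums of independent centered
random variables with a common bound on an exponential moment. -/
theorem exists_integral_rpow_abs_normalized_sum_le {s M p : ℝ} (hs : 0 < s) (hp : 0 < p) :
    ∃ C : ℝ, 0 < C ∧ ∀ (n : ℕ), 0 < n → ∀ (Ω : Type*) [MeasurableSpace Ω] (P : Measure Ω)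
      [IsProbabilityMeasure P] (Y : Fin n → Ω → ℝ), iIndepFun Y P → (∀ i, AEMeasurable (Y i) P) →
      (∀ i, Integrable (fun ω => Real.exp (s * |Y i ω|)) P) →
      (∀ i, ∫ ω, Real.exp (s * |Y i ω|) ∂P ≤ M) → (∀ i, ∫ ω, Y i ω ∂P = 0) →
      Integrable (fun ω => |1 / √(n : ℝ) * ∑ i, Y i ω| ^ p) P ∧
        ∫ ω, |1 / √(n : ℝ) * ∑ i, Y i ω| ^ p ∂P ≤ C := by
  set D := 8 / s ^ 2 * M with hD
  -- The constant in `|z| ^ p ≤ c * exp (|s / 2| * |z|)`.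
  set c := (p / |s / 2|) ^ p with hc
  have hs2 : 0 < |s / 2| := by positivity
  have hcpos : 0 < c := Real.rpow_pos_of_pos (by positivity) _
  refine ⟨c * (2 * Real.exp ((s / 2) ^ 2 * D)), by positivity, ?_⟩
  intro n hn Ω _ P _ Y hindep hmeas hint hM h0
  have hn1 : (1 : ℝ) ≤ n := by exact_mod_cast hn
  have hsq : 1 ≤ √(n : ℝ) := Real.one_le_sqrt.2 hn1
  have hmgf (σ : ℝ) (hσ : |σ| = s / 2) :
      Integrable (fun ω => Real.exp (σ * (1 / √(n : ℝ) * ∑ i, Y i ω))) P ∧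
        ∫ ω, Real.exp (σ * (1 / √(n : ℝ) * ∑ i, Y i ω)) ∂P ≤ Real.exp ((s / 2) ^ 2 * D) := by
    have hτ : |σ / √(n : ℝ)| ≤ s / 2 := by
      rw [abs_div, hσ, abs_of_nonneg (Real.sqrt_nonneg _)]
      exact div_le_self (by positivity) hsq
    have hfun : (fun ω => Real.exp (σ * (1 / √(n : ℝ) * ∑ i, Y i ω))) =
        fun ω => Real.exp (σ / √(n : ℝ) * (∑ i, Y i) ω) := by
      funext ω
      rw [Finset.sum_apply]
      ring_nf
    have hprod := hindep.mgf_sum₀ (t := σ / √(n : ℝ)) hmeas Finset.univ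
    rw [hfun]
    constructor
    -- A non-integrable exponential has `mgf` equal to 0, so positivity of the product yields
    -- integrability.
    · rw [← mgf_pos_iff, hprod]
      exact Finset.prod_pos fun i _ => mgf_pos
        (integrable_exp_mul_of_integrable_exp_mul_abs (by linarith) (hmeas i) (hint i))
    · change mgf (∑ i, Y i) P (σ / √(n : ℝ)) ≤ _
      rw [hprod]
      calc ∏ i, mgf (Y i) P (σ / √(n : ℝ))
          ≤ ∏ _i : Fin n, Real.exp ((σ / √(n : ℝ)) ^ 2 * D) :=
            Finset.prod_le_prod (fun _ _ => mgf_nonneg) fun i _ =>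
              mgf_le_exp_sq_of_integral_eq_zero hs hτ (hmeas i) (hint i) (hM i) (h0 i)
        -- The `n` factors cancel the `1 / n` in the squared argument, whence uniformity in `n`.
        _ = Real.exp ((s / 2) ^ 2 * D) := by
            rw [Finset.prod_const, Finset.card_univ, Fintype.card_fin, ← Real.exp_nat_mul,
              div_pow, Real.sq_sqrt (by positivity), ← hσ, sq_abs]
            congr 1
            field_simp
  obtain ⟨hi1, hb1⟩ := hmgf (s / 2) (abs_of_pos (by positivity))
  obtain ⟨hi2, hb2⟩ := hmgf (-(s / 2)) (by rw [abs_neg, abs_of_pos (by positivity)])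
  have hbound (ω : Ω) : |1 / √(n : ℝ) * ∑ i, Y i ω| ^ p ≤
      c * (Real.exp (s / 2 * (1 / √(n : ℝ) * ∑ i, Y i ω)) +
        Real.exp (-(s / 2) * (1 / √(n : ℝ) * ∑ i, Y i ω))) := by
    refine (rpow_abs_le_mul_exp_abs _ hp.le (by positivity : s / 2 ≠ 0)).trans ?_
    refine mul_le_mul_of_nonneg_left ?_ hcpos.le
    rw [abs_of_pos (by positivity : 0 < s / 2), neg_mul, ← mul_neg]
    rcases abs_cases (1 / √(n : ℝ) * ∑ i, Y i ω) with h | h <;> rw [h.1]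
    · linarith [Real.exp_pos (s / 2 * -(1 / √(n : ℝ) * ∑ i, Y i ω))]
    · linarith [Real.exp_pos (s / 2 * (1 / √(n : ℝ) * ∑ i, Y i ω))]
  have hdom := (hi1.add hi2).const_mul c
  have hI : Integrable (fun ω => |1 / √(n : ℝ) * ∑ i, Y i ω| ^ p) P := by
    refine hdom.mono' ?_ (ae_of_all _ fun ω => ?_)
    · exact AEMeasurable.aestronglyMeasurable (by fun_prop)
    · rw [Real.norm_eq_abs, abs_of_nonneg (by positivity)]
      exact hbound ω
  refine ⟨hI, (integral_mono hI hdom hbound).trans ?_⟩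
  rw [integral_const_mul, Pi.add_def, integral_add hi1 hi2]
  gcongr
  linarith

/-! ### Laws and independence under Gaussian initialization -/

namespace ShallowNN

/-- The pair of preactivations of a neuron at the inputs `x`, `x'`, as a function of its incoming
weights. -/
noncomputable def preactivationPair {n₀ : ℕ} (x x' w : EuclideanSpace ℝ (Fin n₀)) :
    EuclideanSpace ℝ (Fin 2) :=
  !₂[1 / √(n₀ : ℝ) * ∑ u, x u * w u, 1 / √(n₀ : ℝ) * ∑ u, x' u * w u]

lemma inner_preactivationPair {n₀ : ℕ} (x x' w : EuclideanSpace ℝ (Fin n₀))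
    (t : EuclideanSpace ℝ (Fin 2)) :
    ⟪preactivationPair x x' w, t⟫ = ⟪w, (1 / √(n₀ : ℝ)) • (t 0 • x + t 1 • x')⟫ := by
  simp only [preactivationPair, PiLp.inner_apply, Fin.sum_univ_two, RCLike.inner_apply,
    conj_trivial, PiLp.smul_apply, PiLp.add_apply, smul_eq_mul, Matrix.cons_val_zero,
    Matrix.cons_val_one, Finset.mul_sum, ← Finset.sum_add_distrib]
  refine Finset.sum_congr rfl fun u _ => ?_
  ring

lemma measurable_preactivationPair {n₀ : ℕ} (x x' : EuclideanSpace ℝ (Fin n₀)) :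
    Measurable (preactivationPair x x') := by
  refine (PiLp.continuous_toLp 2 _).measurable.comp (measurable_pi_iff.2 fun i => ?_)
  fin_cases i <;> simp <;> fun_prop

/-- Characteristic functions agree: the quadratic form of `covMatrix` at `t` is the squared norm of
the adjoint of the pair map at `t`. -/
lemma measurePreserving_preactivationPair {n₀ : ℕ} (x x' : EuclideanSpace ℝ (Fin n₀)) :
    MeasurePreserving (preactivationPair x x') (stdGaussian (EuclideanSpace ℝ (Fin n₀)))
      (multivariateGaussian 0 (covMatrix x x')) where
  measurable := measurable_preactivationPair x x'
  map_eq := by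
    have := Measure.isProbabilityMeasure_map (μ := stdGaussian (EuclideanSpace ℝ (Fin n₀)))
      (measurable_preactivationPair x x').aemeasurable
    refine Measure.ext_of_charFun (funext fun t => ?_)
    rw [charFun_multivariateGaussian (covMatrix_posSemidef x x'), charFun_apply,
      integral_map (measurable_preactivationPair x x').aemeasurable (by fun_prop)]
    simp only [inner_preactivationPair]
    rw [← charFun_apply, charFun_stdGaussian]
    congr 1
    have hnorm : ‖(1 / √(n₀ : ℝ)) • (t 0 • x + t 1 • x')‖ ^ 2 =
        t.ofLp ⬝ᵥ (covMatrix x x').mulVec t.ofLp := by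
      rw [← real_inner_self_eq_norm_sq, real_inner_smul_left, real_inner_smul_right, ← mul_assoc,
        one_div_sqrt_mul_self]
      simp only [inner_add_left, inner_add_right, real_inner_smul_left, real_inner_smul_right,
        covMatrix, Ktilde, Matrix.mulVec, dotProduct, Fin.sum_univ_two, Matrix.of_apply,
        Matrix.cons_val_zero, Matrix.cons_val_one, Matrix.cons_val', Matrix.cons_val_fin_one]
      ring
    rw [← Complex.ofReal_pow, hnorm]
    rw [inner_zero_right, Complex.ofReal_zero, zero_mul, zero_sub, neg_div]

/-- The parameters attached to the neuron `v`: `none` is its outer weight and `some u` its weight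
from the input `u`. -/
def neuronIdx {n₀ n₁ : ℕ} (v : Fin n₁) : Option (Fin n₀) → ParamIdx n₀ n₁
  | none => Sum.inr v
  | some u => Sum.inl (u, v)

lemma eq_of_neuronIdx_eq {n₀ n₁ : ℕ} {v w : Fin n₁} {a b : Option (Fin n₀)}
    (h : neuronIdx v a = neuronIdx w b) : v = w := by
  cases a <;> cases b <;> simp_all [neuronIdx]

section GaussianInit

variable {n₀ n₁ : ℕ} {Ω : Type*} [MeasurableSpace Ω] {P : Measure Ω} {θ : Ω → Param n₀ n₁}

/-- All parameters are jointly Gaussian, so independence of the blocks reduces to vanishing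
covariances between coordinates of distinct neurons. -/
lemma IsGaussianInit.iIndepFun_neuron (h : IsGaussianInit P θ) :
    iIndepFun (fun (v : Fin n₁) ω (a : Option (Fin n₀)) => θ ω (neuronIdx v a)) P := by
  refine HasGaussianLaw.iIndepFun_of_covariance_eval
    (X := fun (v : Fin n₁) (a : Option (Fin n₀)) ω => θ ω (neuronIdx v a)) ?_ fun v w hvw a b => ?_
  · have hG := h.indep.hasGaussianLaw fun i => (h.law i).hasGaussianLaw
    exact hG.map_fun (ContinuousLinearMap.pi fun v : Fin n₁ =>
      ContinuousLinearMap.pi fun a : Option (Fin n₀) =>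
        ContinuousLinearMap.proj (R := ℝ) (φ := fun _ : ParamIdx n₀ n₁ => ℝ) (neuronIdx v a))
  · exact (h.indep.indepFun fun hab => hvw (eq_of_neuronIdx_eq hab)).covariance_eq_zero
      (h.law _).hasGaussianLaw.memLp_two (h.law _).hasGaussianLaw.memLp_two

lemma IsGaussianInit.hasLaw_column (h : IsGaussianInit P θ) (v : Fin n₁) :
    HasLaw (fun ω => (WithLp.toLp 2 fun u => θ ω (Sum.inl (u, v)) : EuclideanSpace ℝ (Fin n₀)))
      (stdGaussian (EuclideanSpace ℝ (Fin n₀))) P := by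
  have hinj : Function.Injective fun u : Fin n₀ => (Sum.inl (u, v) : ParamIdx n₀ n₁) :=
    fun a b hab => by simpa using hab
  have hpi := (h.indep.precomp hinj).hasLaw_pi fun u => h.law (Sum.inl (u, v))
  have hmp : MeasurePreserving (WithLp.toLp 2)
      (Measure.pi fun _ : Fin n₀ => gaussianReal 0 1) (stdGaussian (EuclideanSpace ℝ (Fin n₀))) :=
    ⟨by fun_prop, map_pi_eq_stdGaussian⟩
  exact hmp.hasLaw.comp hpi

lemma IsGaussianInit.hasLaw_preactivationPair (h : IsGaussianInit P θ)
    (x x' : EuclideanSpace ℝ (Fin n₀)) (v : Fin n₁) :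
    HasLaw (fun ω => preactivationPair x x' (WithLp.toLp 2 fun u => θ ω (Sum.inl (u, v))))
      (multivariateGaussian 0 (covMatrix x x')) P :=
  (measurePreserving_preactivationPair x x').hasLaw.comp (h.hasLaw_column v)

lemma IsGaussianInit.integral_preactivation_mul (h : IsGaussianInit P θ)
    (x x' : EuclideanSpace ℝ (Fin n₀)) (v : Fin n₁) {g : ℝ → ℝ} (hg : Measurable g) :
    ∫ ω, g (preactivation x v (innerWeights (θ ω))) *
      g (preactivation x' v (innerWeights (θ ω))) ∂P = gaussianKernel g x x' :=
  (h.hasLaw_preactivationPair x x' v).integral_comp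
    (f := fun z : EuclideanSpace ℝ (Fin 2) => g (z 0) * g (z 1)) (by fun_prop)

lemma IsGaussianInit.integral_sq (h : IsGaussianInit P θ) (i : ParamIdx n₀ n₁) :
    ∫ ω, θ ω i ^ 2 ∂P = 1 := by
  have h0 : ∫ ω, θ ω i ∂P = 0 := by
    rw [(h.law i).integral_eq]
    simp
  rw [← variance_of_integral_eq_zero (h.law i).aemeasurable h0, (h.law i).variance_eq]
  simp

lemma IsGaussianInit.indepFun_column (h : IsGaussianInit P θ) (v : Fin n₁) :
    IndepFun (fun ω => (WithLp.toLp 2 fun u => θ ω (Sum.inl (u, v)) : EuclideanSpace ℝ (Fin n₀)))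
      (fun ω => θ ω (Sum.inr v)) P := by
  classical
  set S : Finset (ParamIdx n₀ n₁) := Finset.univ.image fun u : Fin n₀ => Sum.inl (u, v) with hS
  have hu (u : Fin n₀) : Sum.inl (u, v) ∈ S := by simp [hS]
  have hv : Sum.inr v ∈ ({Sum.inr v} : Finset (ParamIdx n₀ n₁)) := by simp
  have hdisj : Disjoint S {Sum.inr v} := by simp [hS]
  have hind := h.indep.indepFun_finset₀ _ _ hdisj fun i => (h.law i).aemeasurable
  exact hind.comp
    (φ := fun c : S → ℝ => (WithLp.toLp 2 fun u => c ⟨_, hu u⟩ : EuclideanSpace ℝ (Fin n₀)))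
    (ψ := fun c : ({Sum.inr v} : Finset (ParamIdx n₀ n₁)) → ℝ => c ⟨_, hv⟩)
    (by fun_prop) (by fun_prop)

end GaussianInit

end ShallowNN

/-! ### Mean and exponential moment of a neuron's contribution -/

namespace ShallowNN

lemma abs_neuronKernel_le {Φ : ℝ → ℝ} {M M' : ℝ} (hM : ∀ t, |Φ t| ≤ M)
    (hM' : ∀ t, |deriv Φ t| ≤ M') (K a b t : ℝ) :
    |neuronKernel Φ K a b t| ≤ M * M + |K| * (M' * M') * t ^ 2 := by
  have h0 : 0 ≤ M := (abs_nonneg _).trans (hM 0)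
  have h0' : 0 ≤ M' := (abs_nonneg _).trans (hM' 0)
  refine (abs_add_le _ _).trans ?_
  rw [abs_mul, abs_mul, abs_mul, abs_mul, abs_pow, sq_abs, mul_assoc |K|]
  gcongr
  exacts [hM _, hM _, hM' _, hM' _]

lemma measurable_neuronKernel {Φ : ℝ → ℝ} (hΦ : Differentiable ℝ Φ) (K : ℝ) :
    Measurable fun q : ℝ × ℝ × ℝ => neuronKernel Φ K q.1 q.2.1 q.2.2 := by
  have h1 : Measurable Φ := hΦ.continuous.measurable
  have h2 : Measurable (deriv Φ) := measurable_deriv Φ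
  unfold neuronKernel
  fun_prop

section GaussianInit

variable {n₀ n₁ : ℕ} {Ω : Type*} [MeasurableSpace Ω] {P : Measure Ω} {θ : Ω → Param n₀ n₁}
  {Φ : ℝ → ℝ}

/-- The centered contribution of the neuron `v` to the empirical kernel. -/
noncomputable def centeredNeuronKernel (Φ : ℝ → ℝ) (x x' : EuclideanSpace ℝ (Fin n₀))
    (θ : Param n₀ n₁) (v : Fin n₁) : ℝ :=
  neuronKernel Φ (Ktilde x x') (preactivation x v (innerWeights θ))
    (preactivation x' v (innerWeights θ)) (θ (Sum.inr v)) - limitNTK Φ x x'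

lemma IsGaussianInit.aemeasurable_preactivation (h : IsGaussianInit P θ)
    (x : EuclideanSpace ℝ (Fin n₀)) (v : Fin n₁) :
    AEMeasurable (fun ω => preactivation x v (innerWeights (θ ω))) P := by
  have hm (u : Fin n₀) : AEMeasurable (fun ω => θ ω (Sum.inl (u, v))) P := (h.law _).aemeasurable
  simp only [preactivation, innerWeights]
  fun_prop

lemma IsGaussianInit.iIndepFun_centeredNeuronKernel (h : IsGaussianInit P θ)
    (hΦ : Differentiable ℝ Φ) (x x' : EuclideanSpace ℝ (Fin n₀)) :
    iIndepFun (fun v ω => centeredNeuronKernel Φ x x' (θ ω) v) P := by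
  have hmeas : Measurable fun c : Option (Fin n₀) → ℝ =>
      neuronKernel Φ (Ktilde x x') (1 / √(n₀ : ℝ) * ∑ u, x u * c (some u))
        (1 / √(n₀ : ℝ) * ∑ u, x' u * c (some u)) (c none) - limitNTK Φ x x' :=
    ((measurable_neuronKernel hΦ _).comp (by fun_prop :
      Measurable fun c : Option (Fin n₀) → ℝ => (1 / √(n₀ : ℝ) * ∑ u, x u * c (some u),
        1 / √(n₀ : ℝ) * ∑ u, x' u * c (some u), c none))).sub_const _
  exact h.iIndepFun_neuron.comp _ fun _ => hmeas

lemma IsGaussianInit.aemeasurable_centeredNeuronKernel (h : IsGaussianInit P θ)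
    (hΦ : Differentiable ℝ Φ) (x x' : EuclideanSpace ℝ (Fin n₀)) (v : Fin n₁) :
    AEMeasurable (fun ω => centeredNeuronKernel Φ x x' (θ ω) v) P :=
  ((measurable_neuronKernel hΦ _).comp_aemeasurable
    ((h.aemeasurable_preactivation x v).prodMk
      ((h.aemeasurable_preactivation x' v).prodMk (h.law (Sum.inr v)).aemeasurable))).sub_const _

lemma IsGaussianInit.integral_centeredNeuronKernel [IsProbabilityMeasure P]
    (h : IsGaussianInit P θ) (hΦ : Differentiable ℝ Φ) {M M' : ℝ} (hM : ∀ t, |Φ t| ≤ M)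
    (hM' : ∀ t, |deriv Φ t| ≤ M') (x x' : EuclideanSpace ℝ (Fin n₀)) (v : Fin n₁) :
    ∫ ω, centeredNeuronKernel Φ x x' (θ ω) v ∂P = 0 := by
  have hm : Measurable Φ := hΦ.continuous.measurable
  have hm' : Measurable (deriv Φ) := measurable_deriv Φ
  have hx := h.aemeasurable_preactivation x v
  have hx' := h.aemeasurable_preactivation x' v
  have hprod {g : ℝ → ℝ} (hg : Measurable g) {B : ℝ} (hB : ∀ t, |g t| ≤ B) :
      Integrable (fun ω => g (preactivation x v (innerWeights (θ ω))) *
        g (preactivation x' v (innerWeights (θ ω)))) P := by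
    refine (integrable_const (B * B)).mono' (AEMeasurable.aestronglyMeasurable (by fun_prop))
      (ae_of_all _ fun ω => ?_)
    rw [Real.norm_eq_abs, abs_mul]
    exact mul_le_mul (hB _) (hB _) (abs_nonneg _) ((abs_nonneg _).trans (hB 0))
  have hind : IndepFun (fun ω => deriv Φ (preactivation x v (innerWeights (θ ω))) *
        deriv Φ (preactivation x' v (innerWeights (θ ω))))
      (fun ω => θ ω (Sum.inr v) ^ 2) P :=
    (h.indepFun_column v).comp
      (φ := fun w : EuclideanSpace ℝ (Fin n₀) =>
        deriv Φ (1 / √(n₀ : ℝ) * ∑ u, x u * w u) * deriv Φ (1 / √(n₀ : ℝ) * ∑ u, x' u * w u))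
      (ψ := fun t : ℝ => t ^ 2) (by fun_prop) (by fun_prop)
  have hsq : Integrable (fun ω => θ ω (Sum.inr v) ^ 2) P :=
    (h.law (Sum.inr v)).hasGaussianLaw.memLp_two.integrable_sq
  have hint := hind.integrable_mul (hprod hm' hM') hsq
  have hval := hind.integral_fun_mul_eq_mul_integral (hprod hm' hM').aestronglyMeasurable
    hsq.aestronglyMeasurable
  rw [h.integral_preactivation_mul x x' v hm', h.integral_sq, mul_one] at hval
  simp only [centeredNeuronKernel, neuronKernel]
  have hK := hint.const_mul (Ktilde x x')
  simp only [Pi.mul_apply] at hK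
  have hsum := (hprod hm hM).add hK
  rw [Pi.add_def] at hsum
  rw [integral_sub hsum (integrable_const _), integral_add (hprod hm hM) hK,
    integral_const_mul, hval, h.integral_preactivation_mul x x' v hm]
  simp [limitNTK]

/-- The neuron contributions have an exponential moment that depends neither on the width nor on
the underlying probability space. -/
lemma exists_integral_exp_centeredNeuronKernel_le {M M' : ℝ} (hM : ∀ t, |Φ t| ≤ M)
    (hM' : ∀ t, |deriv Φ t| ≤ M') (hΦ : Differentiable ℝ Φ) (x x' : EuclideanSpace ℝ (Fin n₀)) :
    ∃ s > 0, ∃ B : ℝ, ∀ (n₁ : ℕ) (Ω : Type*) [MeasurableSpace Ω] (P : Measure Ω)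
      (θ : Ω → Param n₀ n₁), IsGaussianInit P θ → ∀ v,
      Integrable (fun ω => Real.exp (s * |centeredNeuronKernel Φ x x' (θ ω) v|)) P ∧
        ∫ ω, Real.exp (s * |centeredNeuronKernel Φ x x' (θ ω) v|) ∂P ≤ B := by
  -- Fernique's theorem supplies a rate `c` for `exp (c * t ^ 2)`; `s` is then chosen so that `s * b
  -- ≤ c`, the `+ 1` covering `b = 0`.
  obtain ⟨c, hc, hint⟩ := IsGaussian.exists_integrable_exp_sq (gaussianReal 0 1)
  set b := |Ktilde x x'| * (M' * M') with hb
  have hb0 : 0 ≤ b := mul_nonneg (abs_nonneg _) (mul_self_nonneg _)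
  set a := M * M + |limitNTK Φ x x'| with ha
  set s := c / (b + 1) with hs
  have hs0 : 0 < s := by positivity
  have hsb : s * b ≤ c := by
    rw [hs, div_mul_eq_mul_div, div_le_iff₀ (by positivity)]
    nlinarith
  refine ⟨s, hs0, Real.exp (s * a) * ∫ z, Real.exp (c * ‖z‖ ^ 2) ∂(gaussianReal 0 1), ?_⟩
  intro n₁ Ω _ P θ h v
  have hlaw := h.law (Sum.inr v)
  have hbound (ω : Ω) : Real.exp (s * |centeredNeuronKernel Φ x x' (θ ω) v|) ≤
      Real.exp (s * a) * Real.exp (c * ‖θ ω (Sum.inr v)‖ ^ 2) := by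
    rw [← Real.exp_add, Real.exp_le_exp, Real.norm_eq_abs, sq_abs]
    have h1 : |centeredNeuronKernel Φ x x' (θ ω) v| ≤ a + b * θ ω (Sum.inr v) ^ 2 := by
      refine (abs_sub _ _).trans ?_
      linarith [abs_neuronKernel_le hM hM' (Ktilde x x') (preactivation x v (innerWeights (θ ω)))
        (preactivation x' v (innerWeights (θ ω))) (θ ω (Sum.inr v))]
    calc s * |centeredNeuronKernel Φ x x' (θ ω) v|
        ≤ s * (a + b * θ ω (Sum.inr v) ^ 2) := by gcongr
      _ = s * a + s * b * θ ω (Sum.inr v) ^ 2 := by ring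
      _ ≤ _ := by gcongr
  have hdom : Integrable (fun ω => Real.exp (s * a) * Real.exp (c * ‖θ ω (Sum.inr v)‖ ^ 2)) P := by
    refine Integrable.const_mul ?_ _
    rw [← hlaw.map_eq] at hint
    exact hint.comp_aemeasurable hlaw.aemeasurable
  have hmeas := h.aemeasurable_centeredNeuronKernel hΦ x x' v
  have hI : Integrable (fun ω => Real.exp (s * |centeredNeuronKernel Φ x x' (θ ω) v|)) P := by
    refine hdom.mono' (AEMeasurable.aestronglyMeasurable (by fun_prop)) (ae_of_all _ fun ω => ?_)
    rw [Real.norm_eq_abs, Real.abs_exp]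
    exact hbound ω
  refine ⟨hI, (integral_mono hI hdom hbound).trans_eq ?_⟩
  rw [integral_const_mul]
  congr 1
  exact hlaw.integral_comp (f := fun z : ℝ => Real.exp (c * ‖z‖ ^ 2)) (by fun_prop)

lemma empiricalNTK_sub_limitNTK (hΦ : Differentiable ℝ Φ) (hn₁ : 0 < n₁)
    (x x' : EuclideanSpace ℝ (Fin n₀)) (θ : Param n₀ n₁) :
    empiricalNTK Φ x x' θ - limitNTK Φ x x' =
      1 / √(n₁ : ℝ) * (1 / √(n₁ : ℝ) * ∑ v, centeredNeuronKernel Φ x x' θ v) := by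
  have hn : (n₁ : ℝ) ≠ 0 := by positivity
  rw [← mul_assoc, one_div_sqrt_mul_self, empiricalNTK_eq_sum hΦ]
  simp only [centeredNeuronKernel, Finset.sum_sub_distrib, Finset.sum_const, Finset.card_univ,
    Fintype.card_fin, nsmul_eq_mul]
  field_simp

end GaussianInit

end ShallowNN

theorem propositionB2 (Φ : ℝ → ℝ) (hΦ : Differentiable ℝ Φ)
    (hΦb : ∃ M : ℝ, ∀ t, |Φ t| ≤ M) (hΦ'b : ∃ M : ℝ, ∀ t, |deriv Φ t| ≤ M)
    (n₀ : ℕ) (hn₀ : 0 < n₀) (x x' : EuclideanSpace ℝ (Fin n₀)) (p : ℝ) (hp : 0 < p) :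
    ∃ C : ℝ, 0 < C ∧
      ∀ (n₁ : ℕ), 0 < n₁ →
      ∀ (Ω : Type*) [MeasurableSpace Ω] (P : Measure Ω) [IsProbabilityMeasure P]
        (θ : Ω → ShallowNN.Param n₀ n₁), ShallowNN.IsGaussianInit P θ →
        -- the hidden-layer kernel is deterministic and equal to its limit
        (∀ i : Fin n₁,
          (∀ w : ShallowNN.Param n₀ n₁,
            ShallowNN.hiddenNTK x x' w i i = ShallowNN.Ktilde x x') ∧
          ∫ ω, |ShallowNN.hiddenNTK x x' (θ ω) i i - ShallowNN.Ktilde x x'| ^ p ∂P = 0) ∧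
        -- the empirical kernel is close to the limiting kernel
        Integrable (fun ω =>
          |ShallowNN.empiricalNTK Φ x x' (θ ω) - ShallowNN.limitNTK Φ x x'| ^ p) P ∧
        ∫ ω, |ShallowNN.empiricalNTK Φ x x' (θ ω) - ShallowNN.limitNTK Φ x x'| ^ p ∂P
          ≤ C / (n₁ : ℝ) ^ (p / 2) := by
  obtain ⟨M, hM⟩ := hΦb
  obtain ⟨M', hM'⟩ := hΦ'b
  obtain ⟨s, hs, B, hB⟩ :=
    ShallowNN.exists_integral_exp_centeredNeuronKernel_le hM hM' hΦ x x'
  obtain ⟨C, hC, hmom⟩ := exists_integral_rpow_abs_normalized_sum_le (M := B) hs hp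
  refine ⟨C, hC, fun n₁ hn₁ Ω _ P _ θ h => ⟨fun i => ⟨fun w => ShallowNN.hiddenNTK_self x x' w i,
    by simp [ShallowNN.hiddenNTK_self, Real.zero_rpow hp.ne']⟩, ?_⟩⟩
  obtain ⟨hI, hle⟩ := hmom n₁ hn₁ Ω P
    (fun v ω => ShallowNN.centeredNeuronKernel Φ x x' (θ ω) v)
    (h.iIndepFun_centeredNeuronKernel hΦ x x') (h.aemeasurable_centeredNeuronKernel hΦ x x')
    (fun v => (hB n₁ Ω P θ h v).1) (fun v => (hB n₁ Ω P θ h v).2)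
    (h.integral_centeredNeuronKernel hΦ hM hM' x x')
  have hfun (ω : Ω) : |ShallowNN.empiricalNTK Φ x x' (θ ω) - ShallowNN.limitNTK Φ x x'| ^ p =
      1 / (n₁ : ℝ) ^ (p / 2) *
        |1 / √(n₁ : ℝ) * ∑ v, ShallowNN.centeredNeuronKernel Φ x x' (θ ω) v| ^ p := by
    -- The outer of the two `1 / √n₁` factors carries the whole rate; the inner one normalizes the
    -- sum.
    have hpow : (1 / √(n₁ : ℝ)) ^ p = 1 / (n₁ : ℝ) ^ (p / 2) := by
      rw [Real.div_rpow zero_le_one (Real.sqrt_nonneg _), Real.one_rpow, Real.sqrt_eq_rpow,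
        ← Real.rpow_mul (Nat.cast_nonneg _), one_div_mul_eq_div]
    rw [ShallowNN.empiricalNTK_sub_limitNTK hΦ hn₁, abs_mul,
      Real.mul_rpow (abs_nonneg _) (abs_nonneg _), abs_of_nonneg (by positivity), hpow]
  simp only [hfun]
  refine ⟨hI.const_mul _, ?_⟩
  rw [integral_const_mul, one_div_mul_eq_div]
  gcongr
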